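/- Let $N\in\mathbb N$, let $x_0\le x_1$ be real numbers, and let $\mathbb{R}^N\times[x_0,x_1]\to\mathbb{R}$, $(u,x)\mapsto F_u(x)$, be a smooth function. For $x\in[x_0,x_1]$ write $F(x)$ for the function $\mathbb{R}^N\to\mathbb{R}$, $u\mapsto F_u(x)$, and $F'(x)$ for the function $u\mapsto \frac{d}{dx}F_u(x)$ (one-sided derivatives at the endpoints). Let $\rho$ be a probability density on $\mathbb{R}^N$. For a smooth $f\colon\mathbb{R}^N\to\mathbb{R}$ whose gradient vanishes only on a null set, a measurable $Z\colon\mathbb{R}^N\to[0,\infty]$, and a regular value $a\in\mathbb{R}$ of $f$, put $H=f^{-1}(a)$, let $dH$ denote its $(N-1)$-dimensional volume element, and define $$\rho_f(a)=\int_{H}\frac{\rho}{\|\nabla f\|}\,dH,\qquad \mathbb{E}(Z\mid f=a)=\int_H Z\,\rho_H\,dH,\quad \rho_H=\frac{1}{\rho_f(a)}\,\frac{\rho}{\|\nabla f\|},$$ where the product $\mathbb{E}(Z\mid f=a)\,\rho_f(a)$ is read as $0$ if $\rho_f(a)=0$. (Almost every $a\in\mathbb{R}$ is a regular value with $\rho_f(a)<\infty$.)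 Assume: 1. for every $x\in[x_0,x_1]$ the set $\{u\in\mathbb{R}^N : \nabla F(x)(u)=0\}$ has Lebesgue measure zero; 2. for Lebesgue-almost every $u\in\mathbb{R}^N$ the function $F_u\colon[x_0,x_1]\to\mathbb{R}$ has only finitely many zeros; 3. there are an integrable function $g\colon[x_0,x_1]\to[0,\infty]$ and an $\varepsilon>0$ such that for every $x\in[x_0,x_1]$ and almost every $a\in(-\varepsilon,\varepsilon)$, $$\mathbb{E}\big(|F'(x)|\,\big|\,F(x)=a\big)\,\rho_{F(x)}(a)\ \le\ g(x).$$ Then, for random $u$ with density $\rho$, the number of zeros $\#\{x\in[x_0,x_1] : F_u(x)=0\}$ is a random variable (measurable up to null sets) and $$\mathbb{E}\,\#\{x\in[x_0,x_1] : F_u(x)=0\}\ \le\ \int_{x_0}^{x_1} g(x)\,dx .$$ -/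

import Mathlib

open MeasureTheory Set
open scoped ENNReal ContDiff

noncomputable section

namespace Rice

variable {N : ℕ}

/-- The fiber `f⁻¹(a)` of a function on `ℝ^N`. -/
def fiber (f : EuclideanSpace ℝ (Fin N) → ℝ) (a : ℝ) : Set (EuclideanSpace ℝ (Fin N)) :=
  f ⁻¹' {a}

/-- The volume measure `dH` of the hypersurface `H = f⁻¹(a)`: the `(N-1)`-dimensional Hausdorff
measure of Euclidean space (normalized so as to agree with Lebesgue measure in dimension `N - 1`),
restricted to `H`. At a regular value `a` of a smooth `f` it is the Riemannian volume of the smooth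
hypersurface `H`. It is only used for `N ≥ 1`. -/
def fiberVolume (f : EuclideanSpace ℝ (Fin N) → ℝ) (a : ℝ) :
    Measure (EuclideanSpace ℝ (Fin N)) :=
  (Measure.euclideanHausdorffMeasure (N - 1)).restrict (fiber f a)

/-- The weight `ρ(u) / ‖∇f(u)‖`. At a critical point of `f` the (real) inverse gives the value `0`;
a fiber over a regular value contains no critical point, and almost every value of a smooth `f` is
regular. -/
def weight (ρ : EuclideanSpace ℝ (Fin N) → ℝ≥0∞) (f : EuclideanSpace ℝ (Fin N) → ℝ)
    (u : EuclideanSpace ℝ (Fin N)) : ℝ≥0∞ :=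
  ρ u * ENNReal.ofReal ‖gradient f u‖⁻¹

/-- The density `ρ_f(a) = ∫_{f⁻¹(a)} ρ / ‖∇f‖ dH ∈ [0, ∞]` of the random variable `f(u)`, where
`u` has the density `ρ`. -/
def pushDensity (ρ : EuclideanSpace ℝ (Fin N) → ℝ≥0∞) (f : EuclideanSpace ℝ (Fin N) → ℝ)
    (a : ℝ) : ℝ≥0∞ :=
  ∫⁻ u, weight ρ f u ∂(fiberVolume f a)

/-- The conditional density `ρ_H(u) = ρ_f(a)⁻¹ * ρ(u) / ‖∇f(u)‖` on `H = f⁻¹(a)`. -/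
def condDensity (ρ : EuclideanSpace ℝ (Fin N) → ℝ≥0∞) (f : EuclideanSpace ℝ (Fin N) → ℝ)
    (a : ℝ) (u : EuclideanSpace ℝ (Fin N)) : ℝ≥0∞ :=
  (pushDensity ρ f a)⁻¹ * weight ρ f u

/-- The conditional expectation `𝔼(Z | f = a) = ∫_H Z ρ_H dH ∈ [0, ∞]` of a nonnegative `Z`. It is
meaningful when `ρ_f(a) > 0`; when `ρ_f(a) = 0`, the product `𝔼(Z | f = a) * ρ_f(a)` is `0`. -/
def condExpect (ρ : EuclideanSpace ℝ (Fin N) → ℝ≥0∞) (f : EuclideanSpace ℝ (Fin N) → ℝ)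
    (Z : EuclideanSpace ℝ (Fin N) → ℝ≥0∞) (a : ℝ) : ℝ≥0∞ :=
  ∫⁻ u, Z u * condDensity ρ f a u ∂(fiberVolume f a)

/-- The zeros of `h` in `[x₀, x₁]`. -/
def zerosOn (h : ℝ → ℝ) (x₀ x₁ : ℝ) : Set ℝ := {x | x ∈ Icc x₀ x₁ ∧ h x = 0}

/-- The number of zeros of `h` in `[x₀, x₁]`, possibly infinite, as an element of `[0, ∞]`. -/
def zeroCount (h : ℝ → ℝ) (x₀ x₁ : ℝ) : ℝ≥0∞ := ((zerosOn h x₀ x₁).encard : ℝ≥0∞)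

end Rice

end

noncomputable section

namespace Rice

open Module Topology Filter
open scoped NNReal InnerProductSpace

/-! The bound rests on Kac's inequality. If `h` has finitely many zeros in an interval, none at an
endpoint, then for all small `δ` the integral of `|h'|` over `{|h| < δ}` is at least `2δ` times the
number of zeros, since `|h|` sweeps through `(0, δ)` on each side of each zero
(`eventually_zeroCount_le_lintegral`). This needs neither a sign change nor a nonzero derivative at
the zero.

Apply this to `F_u`, divide by `2δ` and integrate over `u`. Fatou's lemma bounds the expected count
by a liminf of double integrals, and Tonelli moves the integral over `x` outside. For fixed `x`, the
coarea formula writes the expectation of `|F'(x)|` on `{|F(x)| < δ}` as the integral over `a ∈ (-δ,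
δ)` of `𝔼(|F'(x)| | F(x) = a) ρ_{F(x)}(a)`, hence it is at most `2δ g(x)`
(`lintegral_near_zero_le`). Zeros at the endpoints have probability zero, again by coarea.

The coarea formula is proved for differentiable `f`. The noncritical set splits into countably many
pieces on which `f` is close to a linear form `⟪v, ·⟫`. On such a piece `straighten` is bi-Lipschitz
with constant near `1` and carries fibers into parallel hyperplanes, where Fubini applies. As the
constant tends to `1`, both the formula and the measurability in `a` follow. Critical points are cut
out of the fibers, so Sard's theorem is not needed. -/

theorem euclideanHausdorffMeasure_image_le {X Y : Type*} [MetricSpace X] [MetricSpace Y]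
    [MeasurableSpace X] [BorelSpace X] [MeasurableSpace Y] [BorelSpace Y]
    {K : ℝ≥0} {f : X → Y} {s : Set X} (h : LipschitzOnWith K f s) (d : ℕ) :
    μHE[d] (f '' s) ≤ (K : ℝ≥0∞) ^ d * μHE[d] s := by
  simp_rw [Measure.euclideanHausdorffMeasure_def, Measure.smul_apply]
  have := h.hausdorffMeasure_image_le (d := (d : ℝ)) (by positivity)
  rw [ENNReal.rpow_natCast] at this
  calc _ ≤ _ • ((K : ℝ≥0∞) ^ d * μH[(d : ℝ)] s) := by gcongr
    _ = _ := by rw [mul_smul_comm]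

/-! ### Straightening the level sets of a nearly linear function -/

section straighten

variable {E : Type*} [NormedAddCommGroup E] [InnerProductSpace ℝ E]

/-- The map that moves the level sets of `f` onto the hyperplanes orthogonal to `v`. -/
def straighten (f : E → ℝ) (v u : E) : E := u + ((f u - ⟪v, u⟫_ℝ) / ‖v‖ ^ 2) • v

theorem inner_straighten (f : E → ℝ) {v : E} (hv : v ≠ 0) (u : E) :
    ⟪v, straighten f v u⟫_ℝ = f u := by
  have hv2 : ‖v‖ ^ 2 ≠ 0 := by positivity
  simp only [straighten, inner_add_right, inner_smul_right, real_inner_self_eq_norm_sq]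
  field_simp
  ring

theorem norm_straighten_sub (f : E → ℝ) {v : E} (hv : v ≠ 0) (x y : E) :
    ‖straighten f v x - straighten f v y - (x - y)‖ = |f x - f y - ⟪v, x - y⟫_ℝ| / ‖v‖ := by
  have hv0 : ‖v‖ ≠ 0 := by positivity
  have : straighten f v x - straighten f v y - (x - y)
      = ((f x - f y - ⟪v, x - y⟫_ℝ) / ‖v‖ ^ 2) • v := by
    simp only [straighten, inner_sub_right]
    module
  rw [this, norm_smul, Real.norm_eq_abs, abs_div, abs_of_nonneg (sq_nonneg ‖v‖)]
  field_simp

theorem image_straighten_inter (f : E → ℝ) {v : E} (hv : v ≠ 0) (s : Set E) (a : ℝ) :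
    straighten f v '' (s ∩ f ⁻¹' {a}) = straighten f v '' s ∩ {u | ⟪v, u⟫_ℝ = a} := by
  ext u
  constructor
  · rintro ⟨x, ⟨hx, hfx⟩, rfl⟩
    exact ⟨mem_image_of_mem _ hx, by simpa [inner_straighten f hv] using hfx⟩
  · rintro ⟨⟨x, hx, rfl⟩, h⟩
    exact ⟨x, ⟨hx, by simpa [inner_straighten f hv] using h⟩, rfl⟩

end straighten

/-! ### The coarea formula -/

section coarea

variable {E : Type*} [NormedAddCommGroup E] [InnerProductSpace ℝ E] [FiniteDimensional ℝ E]
  [MeasurableSpace E] [BorelSpace E] {n : ℕ}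

/-- The translates of `vᗮ` along `v` parametrize all the hyperplanes isometrically, so the slices
become sections of a measurable set in `ℝ × vᗮ`. -/
theorem measurable_hyperplane_slice (hn : finrank ℝ E = n + 1) {v : E} (hv : v ≠ 0)
    {t : Set E} (ht : MeasurableSet t) :
    Measurable fun a : ℝ => μHE[n] (t ∩ {u | ⟪v, u⟫_ℝ = a}) := by
  have hW : finrank ℝ (ℝ ∙ v)ᗮ = n := by
    have := Fact.mk hn
    exact Submodule.finrank_orthogonal_span_singleton hv
  have hv2 : ‖v‖ ^ 2 ≠ 0 := by positivity
  have hvol : (μHE[n] : Measure (ℝ ∙ v)ᗮ) = volume := by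
    rw [← InnerProductSpace.euclideanHausdorffMeasure_eq_volume, hW]
  let e : ℝ → (ℝ ∙ v)ᗮ → E := fun a y => (a / ‖v‖ ^ 2) • v + y
  have he : Measurable (Function.uncurry e) := by fun_prop
  have hiso : ∀ a, Isometry (e a) := fun a => by
    refine Isometry.of_dist_eq fun x y => ?_
    simp only [e, dist_add_left]
    rfl
  have hr : ∀ a, range (e a) = {u | ⟪v, u⟫_ℝ = a} := by
    intro a
    ext u
    simp only [mem_range, mem_ofPred_eq]
    constructor
    · rintro ⟨y, rfl⟩
      have := Submodule.mem_orthogonal_singleton_iff_inner_right.1 y.2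
      simp only [e, inner_add_right, inner_smul_right, this, real_inner_self_eq_norm_sq]
      field_simp
      simp
    · intro h
      refine ⟨⟨u - (a / ‖v‖ ^ 2) • v, ?_⟩, by simp [e]⟩
      rw [Submodule.mem_orthogonal_singleton_iff_inner_right, inner_sub_right, inner_smul_right,
        real_inner_self_eq_norm_sq, h]
      field_simp
      simp
  have key : ∀ a, μHE[n] (t ∩ {u | ⟪v, u⟫_ℝ = a}) = volume (Prod.mk a ⁻¹' (Function.uncurry e ⁻¹' t)) := by
    intro a
    rw [← hr, ← (hiso a).euclideanHausdorffMeasure_preimage, hvol]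
    rfl
  simp_rw [key]
  exact measurable_measure_prodMk_left (he ht)

theorem lintegral_hyperplane_slice (hn : finrank ℝ E = n + 1) {v : E} (hv : v ≠ 0)
    {t : Set E} (ht : MeasurableSet t) :
    ∫⁻ a : ℝ, μHE[n] (t ∩ {u | ⟪v, u⟫_ℝ = a}) = ‖v‖ₑ * volume t := by
  have hv0 : ‖v‖ ≠ 0 := by positivity
  have hv2 : ‖v‖ ^ 2 ≠ 0 := by positivity
  -- With this direction `w`, the hyperplane through `a • w` is exactly `⟪v, u⟫ = a`; its norm
  -- `‖v‖⁻¹` produces the factor `‖v‖`.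
  have hw : (‖v‖ ^ 2)⁻¹ • v ≠ 0 := by simp [hv]
  have h := EuclideanGeometry.euclideanHausdorffMeasure_eq_lintegral (0 : E) hw ht
  rw [InnerProductSpace.euclideanHausdorffMeasure_eq_volume, hn, Nat.add_sub_cancel] at h
  rw [h, ← mul_assoc]
  have h1 : ‖v‖ₑ * ‖(‖v‖ ^ 2)⁻¹ • v‖ₑ = 1 := by
    rw [← ofReal_norm, ← ofReal_norm, ← ENNReal.ofReal_mul (norm_nonneg _), norm_smul,
      ← ENNReal.ofReal_one, norm_inv, norm_pow, norm_norm]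
    congr 1
    field_simp
  rw [h1, one_mul]
  congr 1
  ext a
  congr 2
  ext u
  have : u ∈ AffineSubspace.mk' (a • (‖v‖ ^ 2)⁻¹ • v +ᵥ (0 : E)) (ℝ ∙ (‖v‖ ^ 2)⁻¹ • v)ᗮ ↔
      ⟪v, u⟫_ℝ = a := by
    rw [AffineSubspace.mem_mk', Submodule.mem_orthogonal_singleton_iff_inner_right]
    simp only [vadd_eq_add, add_zero, vsub_eq_sub, inner_sub_right, inner_smul_right,
      inner_smul_left, real_inner_self_eq_norm_sq]
    simp only [conj_trivial]
    field_simp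
    rw [mul_zero, sub_eq_zero]
  exact this.symm

theorem le_euclideanHausdorffMeasure_image {X Y : Type*} [MetricSpace X] [MetricSpace Y]
    [MeasurableSpace X] [BorelSpace X] [MeasurableSpace Y] [BorelSpace Y] [Nonempty X]
    {K : ℝ≥0} {f : X → Y} {s : Set X}
    (h : ∀ x ∈ s, ∀ y ∈ s, dist x y ≤ K * dist (f x) (f y)) (d : ℕ) :
    μHE[d] s ≤ (K : ℝ≥0∞) ^ d * μHE[d] (f '' s) := by
  have hinj : InjOn f s := fun x hx y hy hxy => by
    have := h x hx y hy
    rw [hxy, dist_self, mul_zero] at this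
    exact dist_le_zero.1 this
  have hl : LipschitzOnWith K (Function.invFunOn f s) (f '' s) := by
    refine LipschitzOnWith.of_dist_le_mul ?_
    rintro _ ⟨x, hx, rfl⟩ _ ⟨y, hy, rfl⟩
    rw [hinj.leftInvOn_invFunOn hx, hinj.leftInvOn_invFunOn hy]
    exact h x hx y hy
  have := euclideanHausdorffMeasure_image_le hl d
  rwa [hinj.leftInvOn_invFunOn.image_image] at this

/-- `T a` is the measure of a hyperplane slice of the straightened set. It stands in for the fiber
measure, whose measurability in `a` is not yet known. -/
theorem exists_measurable_fiber_comparison (hn : finrank ℝ E = n + 1) {f : E → ℝ}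
    {f' : E → E →L[ℝ] ℝ} {s : Set E} (hs : MeasurableSet s)
    (hf' : ∀ x ∈ s, HasFDerivAt f (f' x) x) {v : E} (hv : v ≠ 0) {δ : ℝ≥0} (hδ : δ < 1)
    (h : ApproximatesLinearOn f (innerSL ℝ v) s (δ * ‖v‖₊)) :
    ∃ T : ℝ → ℝ≥0∞, Measurable T ∧
      (∀ a, T a ≤ ((1 - δ)⁻¹ ^ (n + 2) : ℝ≥0) * μHE[n] (s ∩ f ⁻¹' {a})) ∧
      (∀ a, μHE[n] (s ∩ f ⁻¹' {a}) ≤ ((1 - δ)⁻¹ ^ (n + 2) : ℝ≥0) * T a) ∧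
      ∫⁻ x in s, ‖f' x‖ₑ ≤ ((1 - δ)⁻¹ ^ (n + 2) : ℝ≥0) * ∫⁻ a, T a ∧
      ∫⁻ a, T a ≤ ((1 - δ)⁻¹ ^ (n + 2) : ℝ≥0) * ∫⁻ x in s, ‖f' x‖ₑ := by
  have hv0 : 0 < ‖v‖ := norm_pos_iff.2 hv
  set c : ℝ≥0 := (1 - δ)⁻¹ with hc
  have hδ0 : (0 : ℝ) ≤ δ := δ.2
  have hδ1 : (0 : ℝ) < 1 - δ := sub_pos.2 (by exact_mod_cast hδ)
  have hcδ : (c : ℝ) = (1 - (δ : ℝ))⁻¹ := by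
    rw [hc, NNReal.coe_inv, NNReal.coe_sub hδ.le, NNReal.coe_one]
  have hcm : (c : ℝ) * (1 - δ) = 1 := by rw [hcδ]; field_simp
  have hcp : (1 : ℝ) + δ ≤ c := by
    rw [hcδ, le_inv_comm₀ (by positivity) hδ1, ← one_div, le_div_iff₀ (by positivity)]
    nlinarith
  have hc1 : 1 ≤ c := by
    have : (1 : ℝ) ≤ c := by linarith
    exact_mod_cast this
  have hc1' : (1 : ℝ≥0∞) ≤ c := by exact_mod_cast hc1
  set ψ := straighten f v with hψ
  have hclose : ∀ x ∈ s, ∀ y ∈ s, ‖ψ x - ψ y - (x - y)‖ ≤ δ * ‖x - y‖ := by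
    intro x hx y hy
    rw [hψ, norm_straighten_sub f hv, div_le_iff₀ hv0]
    have := h x hx y hy
    simp only [innerSL_apply_apply, Real.norm_eq_abs, NNReal.coe_mul, coe_nnnorm] at this
    linarith
  have hlip : LipschitzOnWith c ψ s := by
    refine LipschitzOnWith.of_dist_le_mul fun x hx y hy => ?_
    rw [dist_eq_norm, dist_eq_norm]
    have h1 := hclose x hx y hy
    have h2 := norm_le_norm_add_norm_sub (x - y) (ψ x - ψ y)
    nlinarith [norm_nonneg (x - y), norm_sub_rev (x - y) (ψ x - ψ y)]
  have hanti : ∀ x ∈ s, ∀ y ∈ s, dist x y ≤ c * dist (ψ x) (ψ y) := by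
    intro x hx y hy
    rw [dist_eq_norm, dist_eq_norm]
    have h1 := hclose x hx y hy
    have h2 := norm_le_norm_add_norm_sub (ψ x - ψ y) (x - y)
    have h3 : (1 - δ) * ‖x - y‖ ≤ ‖ψ x - ψ y‖ := by
      nlinarith [norm_sub_rev (x - y) (ψ x - ψ y)]
    calc ‖x - y‖ = c * ((1 - δ) * ‖x - y‖) := by rw [← mul_assoc, hcm, one_mul]
      _ ≤ _ := by gcongr
  have hinj : InjOn ψ s := fun x hx y hy hxy => by
    have := hanti x hx y hy
    rw [hxy, dist_self, mul_zero] at this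
    exact dist_le_zero.1 this
  have hB : MeasurableSet (ψ '' s) := hs.image_of_continuousOn_injOn hlip.continuousOn hinj
  -- the derivative stays close to `v` almost everywhere
  have hder : ∀ᵐ x ∂volume.restrict s, ‖f' x‖ₑ ≤ c * ‖v‖ₑ ∧ ‖v‖ₑ ≤ c * ‖f' x‖ₑ := by
    have happ : ApproximatesLinearOn ψ (ContinuousLinearMap.id ℝ E) s δ := hclose
    have hψ' : ∀ x ∈ s, HasFDerivWithinAt ψ (ContinuousLinearMap.id ℝ E +
        ((‖v‖ ^ 2)⁻¹ • (f' x - innerSL ℝ v)).smulRight v) s x := by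
      intro x hx
      have h1 : HasFDerivAt (fun u => (‖v‖ ^ 2)⁻¹ • (f u - innerSL ℝ v u))
          ((‖v‖ ^ 2)⁻¹ • (f' x - innerSL ℝ v)) x :=
        ((hf' x hx).fun_sub (innerSL ℝ v).hasFDerivAt).fun_const_smul _
      have h2 := (hasFDerivAt_id x).add (h1.smul_const v)
      refine HasFDerivAt.hasFDerivWithinAt (h2.congr_of_eventuallyEq ?_)
      refine Filter.Eventually.of_forall fun u => ?_
      simp [hψ, straighten, div_eq_inv_mul]
    -- Almost every point of `s` is a density point, where approximation on `s` controls the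
    -- derivative: `ψ' - id` has norm at most `δ`. As this difference has rank at most one, its norm
    -- is `‖f' x - ⟪v, ·⟫‖ / ‖v‖`.
    filter_upwards [happ.norm_fderiv_sub_le volume hs _ hψ'] with x hx
    have hx' : ‖f' x - innerSL ℝ v‖ ≤ δ * ‖v‖ := by
      have h3 : ‖((‖v‖ ^ 2)⁻¹ • (f' x - innerSL ℝ v)).smulRight v‖ ≤ δ := by
        simpa using (show ‖_‖ ≤ (δ : ℝ) from hx)
      rw [ContinuousLinearMap.norm_smulRight_apply, norm_smul, norm_inv, norm_pow, norm_norm] at h3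
      have h4 : (‖v‖ ^ 2)⁻¹ * ‖f' x - innerSL ℝ v‖ * ‖v‖ = ‖f' x - innerSL ℝ v‖ / ‖v‖ := by
        field_simp
      rwa [h4, div_le_iff₀ hv0] at h3
    have e1 := norm_le_norm_add_norm_sub (f' x) (innerSL ℝ v)
    have e2 := norm_le_norm_add_norm_sub (innerSL ℝ v) (f' x)
    rw [norm_sub_rev] at e1
    rw [innerSL_apply_norm] at e1 e2
    have g1 : ‖f' x‖ ≤ c * ‖v‖ := by
      nlinarith [norm_sub_rev (f' x) (innerSL ℝ v)]
    have g2 : ‖v‖ ≤ c * ‖f' x‖ := by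
      calc ‖v‖ = c * ((1 - δ) * ‖v‖) := by rw [← mul_assoc, hcm, one_mul]
        _ ≤ c * ‖f' x‖ := by
          gcongr
          nlinarith [norm_sub_rev (f' x) (innerSL ℝ v)]
    refine ⟨?_, ?_⟩
    · rw [enorm_eq_nnnorm, enorm_eq_nnnorm]; exact_mod_cast g1
    · rw [enorm_eq_nnnorm, enorm_eq_nnnorm]; exact_mod_cast g2
  have hvolE : (μHE[n + 1] : Measure E) = volume := by
    rw [← hn, InnerProductSpace.euclideanHausdorffMeasure_eq_volume]
  have hJ1 : ∫⁻ x in s, ‖f' x‖ₑ ≤ c * ‖v‖ₑ * volume s := by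
    rw [← setLIntegral_const]
    exact lintegral_mono_ae (hder.mono fun x hx => hx.1)
  have hJ2 : ‖v‖ₑ * volume s ≤ c * ∫⁻ x in s, ‖f' x‖ₑ := by
    rw [← setLIntegral_const, ← lintegral_const_mul' _ _ ENNReal.coe_ne_top]
    exact lintegral_mono_ae (hder.mono fun x hx => hx.2)
  have hV1 : volume (ψ '' s) ≤ (c : ℝ≥0∞) ^ (n + 1) * volume s := by
    rw [← hvolE]; exact euclideanHausdorffMeasure_image_le hlip _
  have hV2 : volume s ≤ (c : ℝ≥0∞) ^ (n + 1) * volume (ψ '' s) := by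
    rw [← hvolE]; exact le_euclideanHausdorffMeasure_image hanti _
  -- Fibers cost `c ^ n`. The integrals cost `c ^ (n + 1)` for the volume and one more `c` for
  -- replacing `‖f'‖` by `‖v‖`; a single exponent `n + 2` serves all four bounds.
  have hpow : (c : ℝ≥0∞) ^ n ≤ (c : ℝ≥0∞) ^ (n + 2) := pow_le_pow_right₀ hc1' (by lia)
  simp only [ENNReal.coe_pow]
  refine ⟨fun a => μHE[n] (ψ '' s ∩ {u | ⟪v, u⟫_ℝ = a}), measurable_hyperplane_slice hn hv hB,
    fun a => ?_, fun a => ?_, ?_, ?_⟩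
  · beta_reduce
    rw [hψ, ← image_straighten_inter f hv]
    exact (euclideanHausdorffMeasure_image_le (hlip.mono inter_subset_left) _).trans (by gcongr)
  · beta_reduce
    rw [hψ, ← image_straighten_inter f hv]
    exact (le_euclideanHausdorffMeasure_image
      (fun x hx y hy => hanti x hx.1 y hy.1) _).trans (by gcongr)
  · rw [lintegral_hyperplane_slice hn hv hB]
    calc _ ≤ c * ‖v‖ₑ * volume s := hJ1
      _ ≤ c * ‖v‖ₑ * ((c : ℝ≥0∞) ^ (n + 1) * volume (ψ '' s)) := by gcongr
      _ = _ := by ring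
  · rw [lintegral_hyperplane_slice hn hv hB]
    calc _ ≤ ‖v‖ₑ * ((c : ℝ≥0∞) ^ (n + 1) * volume s) := by gcongr
      _ = (c : ℝ≥0∞) ^ (n + 1) * (‖v‖ₑ * volume s) := by ring
      _ ≤ (c : ℝ≥0∞) ^ (n + 1) * (c * ∫⁻ x in s, ‖f' x‖ₑ) := by gcongr
      _ = _ := by ring

theorem exists_measurable_fiber_comparison_of_ne_zero (hn : finrank ℝ E = n + 1) {f : E → ℝ}
    {f' : E → E →L[ℝ] ℝ} (hfm : Measurable f) {s : Set E} (hs : MeasurableSet s)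
    (hf' : ∀ x ∈ s, HasFDerivAt f (f' x) x) (h0 : ∀ x ∈ s, f' x ≠ 0)
    {δ : ℝ≥0} (hδ0 : δ ≠ 0) (hδ : δ < 1) :
    ∃ T : ℝ → ℝ≥0∞, Measurable T ∧
      (∀ a, T a ≤ ((1 - δ)⁻¹ ^ (n + 2) : ℝ≥0) * μHE[n] (s ∩ f ⁻¹' {a})) ∧
      (∀ a, μHE[n] (s ∩ f ⁻¹' {a}) ≤ ((1 - δ)⁻¹ ^ (n + 2) : ℝ≥0) * T a) ∧
      ∫⁻ x in s, ‖f' x‖ₑ ≤ ((1 - δ)⁻¹ ^ (n + 2) : ℝ≥0) * ∫⁻ a, T a ∧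
      ∫⁻ a, T a ≤ ((1 - δ)⁻¹ ^ (n + 2) : ℝ≥0) * ∫⁻ x in s, ‖f' x‖ₑ := by
  classical
  rcases s.eq_empty_or_nonempty with rfl | hne
  · exact ⟨0, measurable_const, by simp, by simp, by simp, by simp⟩
  obtain ⟨t, A, htd, htm, hst, happ, hA⟩ :=
    exists_partition_approximatesLinearOn_of_hasFDerivWithinAt f s f'
      -- The tolerance must be nonzero for every `A`. The value `1` at `A = 0` is never used,
      -- because each `A k` is a derivative at a point of the nonempty set `s`.
      (fun x hx => (hf' x hx).hasFDerivWithinAt) (fun A => if A = 0 then 1 else δ * ‖A‖₊)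
      (fun A => by
        split_ifs with h
        · exact one_ne_zero
        · exact mul_ne_zero hδ0 (by simpa using h))
  have hA0 : ∀ k, A k ≠ 0 := fun k => by
    obtain ⟨y, hy, h⟩ := hA hne k
    rw [h]; exact h0 y hy
  have key := fun k => exists_measurable_fiber_comparison hn (f := f) (f' := f')
    (hs.inter (htm k)) (fun x hx => hf' x hx.1)
    (v := (InnerProductSpace.toDual ℝ E).symm (A k)) (by simpa using hA0 k) hδ (by
      have h1 : innerSL ℝ ((InnerProductSpace.toDual ℝ E).symm (A k)) = A k := by
        ext x; simp
      have h2 := happ k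
      simp only [if_neg (hA0 k)] at h2
      rw [h1]
      simpa using h2)
  choose T hTm hT1 hT2 hT3 hT4 using key
  have hdisj : Pairwise (Function.onFun Disjoint fun k => s ∩ t k) := fun i j hij =>
    (htd hij).mono inter_subset_right inter_subset_right
  have hsU : s = ⋃ k, s ∩ t k := by
    rw [← inter_iUnion, inter_eq_left.2 hst]
  have hk : ∀ a, μHE[n] (s ∩ f ⁻¹' {a}) = ∑' k, μHE[n] (s ∩ t k ∩ f ⁻¹' {a}) := fun a => by
    rw [← measure_iUnion, ← iUnion_inter, ← hsU]
    · exact fun i j hij => (hdisj hij).mono inter_subset_left inter_subset_left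
    · exact fun k => (hs.inter (htm k)).inter (hfm (measurableSet_singleton a))
  have hJ : ∫⁻ x in s, ‖f' x‖ₑ = ∑' k, ∫⁻ x in s ∩ t k, ‖f' x‖ₑ := by
    conv_lhs => rw [hsU]
    exact lintegral_iUnion (fun k => hs.inter (htm k)) hdisj _
  have hTint : ∫⁻ a, ∑' k, T k a = ∑' k, ∫⁻ a, T k a :=
    lintegral_tsum fun k => (hTm k).aemeasurable
  refine ⟨fun a => ∑' k, T k a, Measurable.tsum hTm, fun a => ?_, fun a => ?_, ?_, ?_⟩
  · rw [hk, ← ENNReal.tsum_mul_left]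
    exact ENNReal.tsum_le_tsum fun k => hT1 k a
  · rw [hk, ← ENNReal.tsum_mul_left]
    exact ENNReal.tsum_le_tsum fun k => hT2 k a
  · rw [hJ, hTint, ← ENNReal.tsum_mul_left]
    exact ENNReal.tsum_le_tsum fun k => hT3 k
  · rw [hJ, hTint, ← ENNReal.tsum_mul_left]
    exact ENNReal.tsum_le_tsum fun k => hT4 k

theorem coarea_set (hn : finrank ℝ E = n + 1) {f : E → ℝ}
    {f' : E → E →L[ℝ] ℝ} (hfm : Measurable f) {s : Set E} (hs : MeasurableSet s)
    (hf' : ∀ x ∈ s, HasFDerivAt f (f' x) x) (h0 : ∀ x ∈ s, f' x ≠ 0) :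
    Measurable (fun a => μHE[n] (s ∩ f ⁻¹' {a})) ∧
      ∫⁻ a, μHE[n] (s ∩ f ⁻¹' {a}) = ∫⁻ x in s, ‖f' x‖ₑ := by
  -- The shift by one gives `δ m = 1 / (m + 2)`, which is below `1` already at `m = 0`.
  let δ : ℕ → ℝ≥0 := fun m => 1 / ((m + 1 : ℕ) + 1)
  have hδ0 : ∀ m, δ m ≠ 0 := fun m => by positivity
  have hδ1 : ∀ m, δ m < 1 := fun m => by
    simp only [δ]
    rw [div_lt_one (by positivity)]
    simp only [lt_add_iff_pos_left]
    positivity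
  let D : ℕ → ℝ≥0 := fun m => (1 - δ m)⁻¹ ^ (n + 2)
  have hD : Tendsto (fun m => (D m : ℝ≥0∞)) atTop (𝓝 1) := by
    have h1 : Tendsto δ atTop (𝓝 0) :=
      (tendsto_one_div_add_atTop_nhds_zero_nat (𝕜 := ℝ≥0)).comp (tendsto_add_atTop_nat 1)
    have h2 : Tendsto D atTop (𝓝 ((1 - 0)⁻¹ ^ (n + 2))) :=
      (((tendsto_const_nhds.sub h1).inv₀ (by simp)).pow _)
    simp only [tsub_zero, inv_one, one_pow] at h2
    simpa using ENNReal.tendsto_coe.2 h2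
  choose T hTm hT1 hT2 hT3 hT4 using fun m =>
    exists_measurable_fiber_comparison_of_ne_zero hn hfm hs hf' h0 (hδ0 m) (hδ1 m)
  have hDm0 : ∀ m, (D m : ℝ≥0∞) ≠ 0 := fun m => by
    have : 0 < 1 - δ m := tsub_pos_of_lt (hδ1 m)
    have : D m ≠ 0 := by positivity
    exact_mod_cast this
  have hmul : ∀ c : ℝ≥0∞, Tendsto (fun m => (D m : ℝ≥0∞) * c) atTop (𝓝 c) := fun c => by
    simpa using ENNReal.Tendsto.mul_const hD (b := c) (Or.inl one_ne_zero)
  have hinv : ∀ c : ℝ≥0∞, Tendsto (fun m => (D m : ℝ≥0∞)⁻¹ * c) atTop (𝓝 c) := fun c => by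
    have : Tendsto (fun m => (D m : ℝ≥0∞)⁻¹) atTop (𝓝 1) := by
      simpa using tendsto_inv_iff.2 hD
    simpa using ENNReal.Tendsto.mul_const this (b := c) (Or.inl one_ne_zero)
  have hlim : ∀ a, Tendsto (fun m => T m a) atTop (𝓝 (μHE[n] (s ∩ f ⁻¹' {a}))) := fun a => by
    refine tendsto_of_tendsto_of_tendsto_of_le_of_le (hinv _) (hmul _) (fun m => ?_)
      (fun m => hT1 m a)
    exact (ENNReal.inv_mul_le_iff (hDm0 m) ENNReal.coe_ne_top).2 (hT2 m a)
  have hmeas : Measurable (fun a => μHE[n] (s ∩ f ⁻¹' {a})) :=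
    measurable_of_tendsto_metrizable hTm (tendsto_pi_nhds.2 hlim)
  have hDD : ∀ c : ℝ≥0∞, Tendsto (fun m => (D m : ℝ≥0∞) * (D m * c)) atTop (𝓝 c) := fun c => by
    have : Tendsto (fun m => (D m : ℝ≥0∞) * D m) atTop (𝓝 1) := by
      simpa using ENNReal.Tendsto.mul hD (Or.inl one_ne_zero) hD (Or.inl one_ne_zero)
    simpa [mul_assoc] using ENNReal.Tendsto.mul_const this (b := c) (Or.inl one_ne_zero)
  refine ⟨hmeas, le_antisymm (ge_of_tendsto' (hDD _) fun m => ?_)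
    (ge_of_tendsto' (hDD _) fun m => ?_)⟩
  · calc _ ≤ ∫⁻ a, D m * T m a := lintegral_mono (hT2 m)
      _ = D m * ∫⁻ a, T m a := lintegral_const_mul _ (hTm m)
      _ ≤ _ := by gcongr; exact hT4 m
  · calc _ ≤ D m * ∫⁻ a, T m a := hT3 m
      _ ≤ D m * ∫⁻ a, D m * μHE[n] (s ∩ f ⁻¹' {a}) := by gcongr with a; exact hT1 m a
      _ = _ := by rw [lintegral_const_mul _ hmeas]

/-- The coarea formula for a differentiable real-valued function. -/
theorem coarea (hn : finrank ℝ E = n + 1) {f : E → ℝ} (hf : Differentiable ℝ f)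
    {w : E → ℝ≥0∞} (hw : Measurable w) :
    Measurable (fun a => ∫⁻ u in {u | fderiv ℝ f u ≠ 0} ∩ f ⁻¹' {a}, w u ∂μHE[n]) ∧
      ∫⁻ a, ∫⁻ u in {u | fderiv ℝ f u ≠ 0} ∩ f ⁻¹' {a}, w u ∂μHE[n] =
        ∫⁻ u, w u * ‖fderiv ℝ f u‖ₑ := by
  have hfm : Measurable f := hf.continuous.measurable
  have hdm : Measurable (fderiv ℝ f) := measurable_fderiv ℝ f
  set R : Set E := {u | fderiv ℝ f u ≠ 0} with hR
  have hRm : MeasurableSet R := (hdm (measurableSet_singleton 0)).compl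
  refine Measurable.ennreal_induction (motive := fun w : E → ℝ≥0∞ =>
    Measurable (fun a => ∫⁻ u in R ∩ f ⁻¹' {a}, w u ∂μHE[n]) ∧
      ∫⁻ a, ∫⁻ u in R ∩ f ⁻¹' {a}, w u ∂μHE[n] = ∫⁻ u, w u * ‖fderiv ℝ f u‖ₑ) ?_ ?_ ?_ hw
  · intro c s hs
    obtain ⟨h1, h2⟩ := coarea_set hn hfm (hs.inter hRm)
      (fun x _ => (hf x).hasFDerivAt) (fun x hx => hx.2)
    have h3 : ∀ a, ∫⁻ u in R ∩ f ⁻¹' {a}, s.indicator (fun _ => c) u ∂μHE[n] =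
        c * μHE[n] (s ∩ R ∩ f ⁻¹' {a}) := fun a => by
      rw [lintegral_indicator hs, setLIntegral_const, Measure.restrict_apply hs, inter_assoc]
    simp_rw [h3]
    refine ⟨h1.const_mul c, ?_⟩
    rw [lintegral_const_mul _ h1, h2, ← lintegral_const_mul _ hdm.enorm,
      ← lintegral_indicator (hs.inter hRm)]
    congr 1 with u
    have hz : u ∉ R → ‖fderiv ℝ f u‖ₑ = 0 := fun hu' => by
      have h0 : fderiv ℝ f u = 0 := by simpa [hR] using hu'
      rw [h0, enorm_eq_nnnorm, nnnorm_zero, ENNReal.coe_zero]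
    by_cases hu : u ∈ s <;> by_cases hu' : u ∈ R <;> simp [hu, hu', hz]
  · intro w₁ w₂ _ hw₁ hw₂ h₁ h₂
    have h3 : ∀ a, ∫⁻ u in R ∩ f ⁻¹' {a}, (w₁ + w₂) u ∂μHE[n] =
        ∫⁻ u in R ∩ f ⁻¹' {a}, w₁ u ∂μHE[n] + ∫⁻ u in R ∩ f ⁻¹' {a}, w₂ u ∂μHE[n] := fun a => by
      simp only [Pi.add_apply]
      exact lintegral_add_left hw₁ _
    simp_rw [h3]
    refine ⟨h₁.1.add h₂.1, ?_⟩
    rw [lintegral_add_left h₁.1, h₁.2, h₂.2, ← lintegral_add_left (f := fun u => w₁ u * ‖fderiv ℝ f u‖ₑ)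
      (hw₁.mul hdm.enorm)]
    simp [add_mul]
  · intro w hwm hmono h
    have h3 : ∀ a, ∫⁻ u in R ∩ f ⁻¹' {a}, ⨆ k, w k u ∂μHE[n] =
        ⨆ k, ∫⁻ u in R ∩ f ⁻¹' {a}, w k u ∂μHE[n] := fun a => lintegral_iSup hwm hmono
    simp_rw [h3, ENNReal.iSup_mul]
    refine ⟨Measurable.iSup fun k => (h k).1, ?_⟩
    rw [lintegral_iSup (fun k => (h k).1), lintegral_iSup]
    · simp_rw [fun k => (h k).2]
    · exact fun k => (hwm k).mul hdm.enorm
    · intro i j hij u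
      dsimp only
      gcongr
      exact hmono hij u
    · intro i j hij a
      exact lintegral_mono (hmono hij)

end coarea

/-! ### Kac's counting inequality -/

theorem measurableSet_inter_preimage_of_continuousOn {X Y : Type*} [TopologicalSpace X]
    [MeasurableSpace X] [OpensMeasurableSpace X] [TopologicalSpace Y] {f : X → Y} {s : Set X}
    {t : Set Y} (hf : ContinuousOn f s) (hs : MeasurableSet s) (ht : IsOpen t) :
    MeasurableSet (s ∩ f ⁻¹' t) := by
  obtain ⟨u, hu, h⟩ := continuousOn_iff'.1 hf t ht
  rw [inter_comm, h]
  exact hu.measurableSet.inter hs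

theorem volume_image_le_lintegral_abs_deriv {h φ : ℝ → ℝ} {s : Set ℝ} (hs : MeasurableSet s)
    (hd : ∀ x ∈ s, HasDerivWithinAt h (φ x) s x) :
    volume (h '' s) ≤ ∫⁻ x in s, ENNReal.ofReal |φ x| := by
  have := addHaar_image_le_lintegral_abs_det_fderiv volume hs
    (fun x hx => (hd x hx).hasFDerivWithinAt)
  simpa using this

/-- By the intermediate value theorem `h` covers `(0, δ)` or `(-δ, 0)`, and an image is no longer
than the integral of `|h'|`. Excluding the value `0` removes the point `c`, so that the pieces to
the left and right of a zero are disjoint. -/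
theorem ofReal_le_lintegral_uIcc {h φ : ℝ → ℝ} {c d δ : ℝ}
    (hd : ∀ x ∈ uIcc c d, HasDerivWithinAt h (φ x) (uIcc c d) x) (hc : h c = 0)
    (hδ : δ ≤ |h d|) :
    ENNReal.ofReal δ ≤ ∫⁻ x in uIcc c d ∩ h ⁻¹' {y | 0 < |y| ∧ |y| < δ},
      ENNReal.ofReal |φ x| := by
  have hcont : ContinuousOn h (uIcc c d) := fun x hx => (hd x hx).continuousWithinAt
  have hopen : IsOpen {y : ℝ | 0 < |y| ∧ |y| < δ} :=
    (isOpen_lt continuous_const continuous_abs).inter (isOpen_lt continuous_abs continuous_const)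
  have hm := measurableSet_inter_preimage_of_continuousOn hcont measurableSet_uIcc hopen
  refine le_trans ?_ (volume_image_le_lintegral_abs_deriv hm
    fun x hx => (hd x hx.1).mono inter_subset_left)
  have hivt : uIcc 0 (h d) ⊆ h '' uIcc c d := hc ▸ intermediate_value_uIcc hcont
  rcases le_total 0 (h d) with h0 | h0
  · have hsub : Ioo 0 δ ⊆ h '' (uIcc c d ∩ h ⁻¹' {y | 0 < |y| ∧ |y| < δ}) := by
      intro y hy
      rw [abs_of_nonneg h0] at hδ
      obtain ⟨x, hx, rfl⟩ := hivt (show y ∈ uIcc 0 (h d) by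
        rw [uIcc_of_le h0]; exact ⟨hy.1.le, hy.2.le.trans hδ⟩)
      refine ⟨x, ⟨hx, ?_⟩, rfl⟩
      simp only [mem_preimage, mem_ofPred_eq, abs_of_pos hy.1]
      exact hy
    simpa using measure_mono (μ := volume) hsub
  · have hsub : Ioo (-δ) 0 ⊆ h '' (uIcc c d ∩ h ⁻¹' {y | 0 < |y| ∧ |y| < δ}) := by
      intro y hy
      rw [abs_of_nonpos h0] at hδ
      obtain ⟨x, hx, rfl⟩ := hivt (show y ∈ uIcc 0 (h d) by
        rw [uIcc_of_ge h0]; exact ⟨by linarith [hy.1], hy.2.le⟩)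
      refine ⟨x, ⟨hx, ?_⟩, rfl⟩
      simp only [mem_preimage, mem_ofPred_eq, abs_of_neg hy.2]
      exact ⟨by linarith [hy.2], by linarith [hy.1]⟩
    simpa using measure_mono (μ := volume) hsub

theorem eventually_le_lintegral_near_zero {h φ : ℝ → ℝ} {x₀ x₁ z : ℝ}
    (hd : ∀ x ∈ Icc x₀ x₁, HasDerivWithinAt h (φ x) (Icc x₀ x₁) x) (hz : z ∈ Ioo x₀ x₁)
    (hz0 : h z = 0) (hiso : ∀ᶠ x in 𝓝 z, x ≠ z → h x ≠ 0) {U : Set ℝ} (hU : U ∈ 𝓝 z) :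
    ∀ᶠ δ in 𝓝[>] (0 : ℝ), ENNReal.ofReal (2 * δ) ≤
      ∫⁻ x in U ∩ (Icc x₀ x₁ ∩ h ⁻¹' Ioo (-δ) δ), ENNReal.ofReal |φ x| := by
  obtain ⟨η, hη, hsub⟩ := Metric.nhds_basis_closedBall.mem_iff.1
    (inter_mem (inter_mem hU (Icc_mem_nhds hz.1 hz.2)) hiso)
  have hball : ∀ x, |x - z| ≤ η → (x ∈ U ∧ x ∈ Icc x₀ x₁) ∧ (x ≠ z → h x ≠ 0) := fun x hx =>
    hsub (by simpa [Real.dist_eq] using hx)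
  have hr0 : h (z + η) ≠ 0 :=
    (hball (z + η) (by simp [abs_of_pos hη])).2 (by simpa using hη.ne')
  have hl0 : h (z - η) ≠ 0 :=
    (hball (z - η) (by simp [abs_of_pos hη])).2 (by simpa using hη.ne')
  have hrI : uIcc z (z + η) ⊆ Icc x₀ x₁ := fun x hx => by
    rw [uIcc_of_le (by linarith)] at hx
    exact (hball x (abs_le.2 ⟨by linarith [hx.1], by linarith [hx.2]⟩)).1.2
  have hlI : uIcc z (z - η) ⊆ Icc x₀ x₁ := fun x hx => by
    rw [uIcc_of_ge (by linarith)] at hx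
    exact (hball x (abs_le.2 ⟨by linarith [hx.1], by linarith [hx.2]⟩)).1.2
  have hrU : uIcc z (z + η) ⊆ U := fun x hx => by
    rw [uIcc_of_le (by linarith)] at hx
    exact (hball x (abs_le.2 ⟨by linarith [hx.1], by linarith [hx.2]⟩)).1.1
  have hlU : uIcc z (z - η) ⊆ U := fun x hx => by
    rw [uIcc_of_ge (by linarith)] at hx
    exact (hball x (abs_le.2 ⟨by linarith [hx.1], by linarith [hx.2]⟩)).1.1
  filter_upwards [self_mem_nhdsWithin, nhdsWithin_le_nhds (Iio_mem_nhds (abs_pos.2 hr0)),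
    nhdsWithin_le_nhds (Iio_mem_nhds (abs_pos.2 hl0))] with δ hδ hδr hδl
  have hopen : IsOpen {y : ℝ | 0 < |y| ∧ |y| < δ} :=
    (isOpen_lt continuous_const continuous_abs).inter (isOpen_lt continuous_abs continuous_const)
  have hR := ofReal_le_lintegral_uIcc (fun x hx => (hd x (hrI hx)).mono hrI) hz0 (le_of_lt hδr)
  have hL := ofReal_le_lintegral_uIcc (fun x hx => (hd x (hlI hx)).mono hlI) hz0 (le_of_lt hδl)
  have hcont : ContinuousOn h (uIcc z (z - η)) := fun x hx =>
    (hd x (hlI hx)).continuousWithinAt.mono hlI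
  rw [two_mul, ENNReal.ofReal_add (le_of_lt hδ) (le_of_lt hδ)]
  refine (add_le_add hR hL).trans ?_
  rw [← lintegral_union (measurableSet_inter_preimage_of_continuousOn hcont measurableSet_uIcc
    hopen)]
  · refine lintegral_mono_set ?_
    rintro x (⟨hx, -, hx2⟩ | ⟨hx, -, hx2⟩)
    · exact ⟨hrU hx, hrI hx, abs_lt.1 hx2⟩
    · exact ⟨hlU hx, hlI hx, abs_lt.1 hx2⟩
  · refine disjoint_left.2 ?_
    rintro x ⟨hx, hx1, -⟩ ⟨hx', -⟩
    rw [uIcc_of_le (by linarith)] at hx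
    rw [uIcc_of_ge (by linarith)] at hx'
    have : x = z := le_antisymm hx'.2 hx.1
    rw [this, hz0, abs_zero] at hx1
    exact lt_irrefl _ hx1

/-- Kac's lower bound for the number of zeros. -/
theorem eventually_zeroCount_le_lintegral {h φ : ℝ → ℝ} {x₀ x₁ : ℝ}
    (hd : ∀ x ∈ Icc x₀ x₁, HasDerivWithinAt h (φ x) (Icc x₀ x₁) x)
    (hfin : (zerosOn h x₀ x₁).Finite) (h₀ : h x₀ ≠ 0) (h₁ : h x₁ ≠ 0) :
    ∀ᶠ δ in 𝓝[>] (0 : ℝ), ENNReal.ofReal (2 * δ) * zeroCount h x₀ x₁ ≤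
      ∫⁻ x in Icc x₀ x₁ ∩ h ⁻¹' Ioo (-δ) δ, ENNReal.ofReal |φ x| := by
  obtain ⟨U, hU, hdisj⟩ := hfin.t2_separation
  have hIoo : ∀ z ∈ zerosOn h x₀ x₁, z ∈ Ioo x₀ x₁ := fun z hz =>
    ⟨lt_of_le_of_ne hz.1.1 fun e => h₀ (e ▸ hz.2), lt_of_le_of_ne hz.1.2 fun e => h₁ (e ▸ hz.2)⟩
  have hcont : ContinuousOn h (Icc x₀ x₁) := fun x hx => (hd x hx).continuousWithinAt
  have hall : ∀ᶠ δ in 𝓝[>] (0 : ℝ), ∀ z ∈ hfin.toFinset, ENNReal.ofReal (2 * δ) ≤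
      ∫⁻ x in U z ∩ (Icc x₀ x₁ ∩ h ⁻¹' Ioo (-δ) δ), ENNReal.ofReal |φ x| := by
    refine (Filter.eventually_all_finset _).2 fun z hz => ?_
    have hz' : z ∈ zerosOn h x₀ x₁ := by simpa using hz
    refine eventually_le_lintegral_near_zero hd (hIoo z hz') hz'.2 ?_
      ((hU z).2.mem_nhds (hU z).1)
    have hcl : (zerosOn h x₀ x₁ \ {z})ᶜ ∈ 𝓝 z :=
      (hfin.subset sdiff_subset).isClosed.isOpen_compl.mem_nhds (by simp)
    filter_upwards [hcl, Icc_mem_nhds (hIoo z hz').1 (hIoo z hz').2] with x hx hxI hne h0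
    exact hx ⟨⟨hxI, h0⟩, hne⟩
  filter_upwards [hall] with δ hδ
  have hA : MeasurableSet (Icc x₀ x₁ ∩ h ⁻¹' Ioo (-δ) δ) :=
    measurableSet_inter_preimage_of_continuousOn hcont measurableSet_Icc isOpen_Ioo
  calc ENNReal.ofReal (2 * δ) * zeroCount h x₀ x₁
      = ∑ z ∈ hfin.toFinset, ENNReal.ofReal (2 * δ) := by
        rw [zeroCount, hfin.encard_eq_coe_toFinset_card]
        simp [mul_comm]
    _ ≤ ∑ z ∈ hfin.toFinset, ∫⁻ x in U z ∩ (Icc x₀ x₁ ∩ h ⁻¹' Ioo (-δ) δ),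
          ENNReal.ofReal |φ x| := Finset.sum_le_sum hδ
    _ = ∫⁻ x in ⋃ z ∈ hfin.toFinset, U z ∩ (Icc x₀ x₁ ∩ h ⁻¹' Ioo (-δ) δ),
          ENNReal.ofReal |φ x| := by
        rw [lintegral_biUnion_finset]
        · intro i hi j hj hij
          exact (hdisj (by simpa using hi) (by simpa using hj) hij).mono
            inter_subset_left inter_subset_left
        · exact fun z _ => (hU z).2.measurableSet.inter hA
    _ ≤ _ := lintegral_mono_set (iUnion₂_subset fun _ _ => inter_subset_right)

/-! ### Measurability of the number of zeros -/

/-- Cells of length `1 / m` separate the points of any given finite subset once `m` is large.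
Counting occupied cells reduces measurability of the count to that of the existence of a zero in a
cell. -/
theorem toENNReal_encard_eq_iSup_image_floor (Z : Set ℝ) :
    (Z.encard : ℝ≥0∞) = ⨆ m : ℕ, (((fun x : ℝ => ⌊(m : ℝ) * x⌋) '' Z).encard : ℝ≥0∞) := by
  refine le_antisymm ?_ (iSup_le fun m => ENat.toENNReal_mono (encard_image_le _ _))
  rw [← ENNReal.tsum_set_one, ENNReal.tsum_eq_iSup_sum]
  refine iSup_le fun s => ?_
  have hev : ∀ᶠ m : ℕ in atTop, ∀ x ∈ s, ∀ y ∈ s,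
      ⌊(m : ℝ) * (x : ℝ)⌋ = ⌊(m : ℝ) * (y : ℝ)⌋ → x = y := by
    refine (Filter.eventually_all_finset _).2 fun x _ =>
      (Filter.eventually_all_finset _).2 fun y _ => ?_
    by_cases hxy : x = y
    · exact Eventually.of_forall fun _ _ => hxy
    have hpos : 0 < |(x : ℝ) - y| := abs_pos.2 (sub_ne_zero.2 fun e => hxy (Subtype.ext e))
    have ht : Tendsto (fun m : ℕ => (m : ℝ) * |(x : ℝ) - y|) atTop atTop :=
      tendsto_natCast_atTop_atTop.atTop_mul_const hpos
    filter_upwards [ht.eventually_ge_atTop 1] with m hm he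
    have := Int.abs_sub_lt_one_of_floor_eq_floor he
    rw [← mul_sub, abs_mul, Nat.abs_cast] at this
    exact absurd this (not_lt.2 hm)
  obtain ⟨m, hm⟩ := hev.exists
  refine le_iSup_of_le m ?_
  have hinj : InjOn (fun x : Z => ⌊(m : ℝ) * (x : ℝ)⌋) (s : Set Z) := fun x hx y hy h =>
    hm x hx y hy h
  have h1 : (fun x : Z => ⌊(m : ℝ) * (x : ℝ)⌋) '' (s : Set Z) ⊆
      (fun x : ℝ => ⌊(m : ℝ) * x⌋) '' Z := by
    rintro _ ⟨x, -, rfl⟩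
    exact ⟨x, x.2, rfl⟩
  have h2 := ENat.toENNReal_mono (encard_le_encard h1)
  rw [hinj.encard_image, encard_coe_eq_coe_finsetCard] at h2
  simpa using h2

/-- Projection along a compact factor is a closed map. -/
theorem isClosed_exists_zero {X : Type*} [TopologicalSpace X] {F : X → ℝ → ℝ} {K : Set ℝ}
    (hK : IsCompact K) (hF : ContinuousOn (fun p : X × ℝ => F p.1 p.2) (univ ×ˢ K)) :
    IsClosed {u | ∃ x ∈ K, F u x = 0} := by
  have := isCompact_iff_compactSpace.1 hK
  have hc : Continuous fun p : X × K => F p.1 p.2 :=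
    hF.comp_continuous (f := fun p : X × K => (p.1, (p.2 : ℝ))) (by fun_prop) (by simp)
  have := isClosedMap_fst_of_compactSpace _ (isClosed_singleton (x := (0 : ℝ)).preimage hc)
  convert this
  ext u
  simp

theorem measurable_zeroCount {X : Type*} [TopologicalSpace X] [MeasurableSpace X]
    [OpensMeasurableSpace X] {F : X → ℝ → ℝ} {x₀ x₁ : ℝ}
    (hF : ContinuousOn (fun p : X × ℝ => F p.1 p.2) (univ ×ˢ Icc x₀ x₁)) :
    Measurable fun u => zeroCount (F u) x₀ x₁ := by
  simp only [zeroCount, toENNReal_encard_eq_iSup_image_floor]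
  refine Measurable.iSup fun m => ?_
  simp_rw [← ENNReal.tsum_set_one, tsum_subtype _ (fun _ : ℤ => (1 : ℝ≥0∞))]
  refine Measurable.tsum fun k => ?_
  -- The cells are half-open; they are exhausted by compact sets so that `isClosed_exists_zero`
  -- applies.
  have hset : {u | k ∈ (fun x : ℝ => ⌊(m : ℝ) * x⌋) '' zerosOn (F u) x₀ x₁} =
      ⋃ j : ℕ, {u | ∃ x ∈ Icc x₀ x₁ ∩ (fun x => (m : ℝ) * x) ⁻¹' Icc (k : ℝ) (k + 1 - 1 / (j + 1)),
        F u x = 0} := by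
    ext u
    simp only [mem_image, mem_ofPred_eq, mem_iUnion]
    constructor
    · rintro ⟨x, ⟨hxI, hx0⟩, hk⟩
      obtain ⟨hk1, hk2⟩ := Int.floor_eq_iff.1 hk
      obtain ⟨j, hj⟩ := exists_nat_one_div_lt (sub_pos.2 hk2)
      exact ⟨j, x, ⟨hxI, hk1, by linarith⟩, hx0⟩
    · rintro ⟨j, x, ⟨hxI, hk1, hk2⟩, hx0⟩
      have : (0 : ℝ) < 1 / (j + 1) := by positivity
      exact ⟨x, ⟨hxI, hx0⟩, Int.floor_eq_iff.2 ⟨hk1, by linarith⟩⟩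
  have hm : MeasurableSet {u | k ∈ (fun x : ℝ => ⌊(m : ℝ) * x⌋) '' zerosOn (F u) x₀ x₁} := by
    rw [hset]
    refine MeasurableSet.iUnion fun j => (isClosed_exists_zero ?_ ?_).measurableSet
    · exact isCompact_Icc.inter_right (isClosed_Icc.preimage (by fun_prop))
    · exact hF.mono (prod_mono_right inter_subset_left)
  exact (measurable_const (a := (1 : ℝ≥0∞))).indicator hm

/-! ### Fiber densities and conditional expectations -/

section density

variable {n : ℕ} {f : EuclideanSpace ℝ (Fin (n + 1)) → ℝ}

theorem gradient_eq_zero_iff {N : ℕ} {f : EuclideanSpace ℝ (Fin N) → ℝ}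
    {u : EuclideanSpace ℝ (Fin N)} : gradient f u = 0 ↔ fderiv ℝ f u = 0 := by
  simp [gradient]

theorem enorm_fderiv_eq {N : ℕ} (f : EuclideanSpace ℝ (Fin N) → ℝ)
    (u : EuclideanSpace ℝ (Fin N)) : ‖fderiv ℝ f u‖ₑ = ENNReal.ofReal ‖gradient f u‖ := by
  simp [gradient]

theorem measurable_weight {N : ℕ} {ρ : EuclideanSpace ℝ (Fin N) → ℝ≥0∞} (hρ : Measurable ρ)
    (f : EuclideanSpace ℝ (Fin N) → ℝ) : Measurable (weight ρ f) := by
  have h : ∀ u, ‖gradient f u‖ = ‖fderiv ℝ f u‖ := fun u => by simp [gradient]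
  unfold weight
  simp_rw [h]
  exact hρ.mul ((measurable_fderiv ℝ f).norm.inv.ennreal_ofReal)

theorem weight_of_gradient_eq_zero {N : ℕ} (ρ : EuclideanSpace ℝ (Fin N) → ℝ≥0∞)
    {f : EuclideanSpace ℝ (Fin N) → ℝ} {u : EuclideanSpace ℝ (Fin N)} (h : gradient f u = 0) :
    weight ρ f u = 0 := by
  simp [weight, h]

theorem weight_mul_norm_gradient {N : ℕ} (ρ : EuclideanSpace ℝ (Fin N) → ℝ≥0∞)
    {f : EuclideanSpace ℝ (Fin N) → ℝ} {u : EuclideanSpace ℝ (Fin N)} (h : gradient f u ≠ 0) :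
    weight ρ f u * ENNReal.ofReal ‖gradient f u‖ = ρ u := by
  have h0 : ‖gradient f u‖ ≠ 0 := norm_ne_zero_iff.2 h
  rw [weight, mul_assoc, ← ENNReal.ofReal_mul (by positivity), inv_mul_cancel₀ h0,
    ENNReal.ofReal_one, mul_one]

/-- The coarea formula for the weighted volume measures of the fibers. -/
theorem coarea_weight (hf : Differentiable ℝ f)
    (hgrad : volume {u | gradient f u = 0} = 0)
    {ρ Z : EuclideanSpace ℝ (Fin (n + 1)) → ℝ≥0∞} (hρ : Measurable ρ) (hZ : Measurable Z) :
    Measurable (fun a => ∫⁻ u, Z u * weight ρ f u ∂fiberVolume f a) ∧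
      ∫⁻ a, ∫⁻ u, Z u * weight ρ f u ∂fiberVolume f a = ∫⁻ u, Z u * ρ u := by
  obtain ⟨h1, h2⟩ := coarea (n := n) (by simp) hf (hZ.mul (measurable_weight hρ f))
  have hm : MeasurableSet {u | fderiv ℝ f u ≠ 0} :=
    (measurable_fderiv ℝ f (measurableSet_singleton 0)).compl
  have h3 : ∀ a, ∫⁻ u in {u | fderiv ℝ f u ≠ 0} ∩ f ⁻¹' {a}, (Z * weight ρ f) u ∂μHE[n] =
      ∫⁻ u, Z u * weight ρ f u ∂fiberVolume f a := fun a => by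
    -- Removing the critical points from the fiber changes nothing, since `weight` is `0` there by
    -- the convention `0⁻¹ = 0`.
    rw [← Measure.restrict_restrict hm, ← lintegral_indicator hm]
    refine lintegral_congr fun u => ?_
    by_cases hu : fderiv ℝ f u = 0
    · simp [hu, weight_of_gradient_eq_zero ρ (gradient_eq_zero_iff.2 hu)]
    · simp [hu]
  simp_rw [h3] at h1 h2
  refine ⟨h1, h2.trans (lintegral_congr_ae ?_)⟩
  have hae : ∀ᵐ u, gradient f u ≠ 0 := by
    rw [ae_iff]; simpa using hgrad
  filter_upwards [hae] with u hu
  rw [enorm_fderiv_eq, Pi.mul_apply, mul_assoc, weight_mul_norm_gradient ρ hu]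

/-- In the coarea formula for the indicator of `f⁻¹(c)`, only the single value `a = c` can
contribute to the outer integral. -/
theorem ae_ne_of_volume_gradient_eq_zero (hf : Differentiable ℝ f)
    (hgrad : volume {u | gradient f u = 0} = 0) (c : ℝ) : ∀ᵐ u, f u ≠ c := by
  have hm : MeasurableSet (f ⁻¹' {c}) := hf.continuous.measurable (measurableSet_singleton c)
  have h := (coarea_weight hf hgrad (ρ := 1) (Z := (f ⁻¹' {c}).indicator 1) measurable_one
    (measurable_one.indicator hm)).2
  have h0 : ∫⁻ a, ∫⁻ u, (f ⁻¹' {c}).indicator 1 u * weight 1 f u ∂fiberVolume f a = 0 := by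
    rw [← lintegral_zero (μ := (volume : Measure ℝ))]
    refine lintegral_congr_ae ?_
    filter_upwards [Measure.ae_ne volume c] with a ha
    rw [← lintegral_zero (μ := fiberVolume f a)]
    refine setLIntegral_congr_fun (hf.continuous.measurable (measurableSet_singleton a))
      fun u hu => ?_
    have : f u ≠ c := fun h => ha (by rw [← h]; exact hu.symm)
    simp [this]
  rw [h0] at h
  simp only [Pi.one_apply, mul_one] at h
  rw [lintegral_indicator_one hm] at h
  rw [ae_iff]
  simp only [not_not]
  exact h.symm

/-- Finiteness is what permits cancelling `ρ_f(a)` when it is nonzero. When it is zero, the weight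
vanishes almost everywhere on the fiber and both sides are `0`. -/
theorem condExpect_mul_pushDensity {N : ℕ} {ρ Z : EuclideanSpace ℝ (Fin N) → ℝ≥0∞}
    {f : EuclideanSpace ℝ (Fin N) → ℝ} (hρ : Measurable ρ) {a : ℝ}
    (hfin : pushDensity ρ f a ≠ ⊤) :
    condExpect ρ f Z a * pushDensity ρ f a = ∫⁻ u, Z u * weight ρ f u ∂fiberVolume f a := by
  by_cases h0 : pushDensity ρ f a = 0
  · rw [h0, mul_zero]
    have : ∀ᵐ u ∂fiberVolume f a, weight ρ f u = 0 :=
      (lintegral_eq_zero_iff (measurable_weight hρ f)).1 h0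
    symm
    rw [← lintegral_zero (μ := fiberVolume f a)]
    refine lintegral_congr_ae ?_
    filter_upwards [this] with u hu
    rw [hu, mul_zero]
  · have h1 : condExpect ρ f Z a =
        (pushDensity ρ f a)⁻¹ * ∫⁻ u, Z u * weight ρ f u ∂fiberVolume f a := by
      rw [condExpect, ← lintegral_const_mul' _ _ (ENNReal.inv_ne_top.2 h0)]
      refine lintegral_congr fun u => ?_
      rw [condDensity]
      ring
    rw [h1, mul_right_comm, ENNReal.inv_mul_cancel h0 hfin, one_mul]

theorem ae_pushDensity_ne_top (hf : Differentiable ℝ f)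
    (hgrad : volume {u | gradient f u = 0} = 0)
    {ρ : EuclideanSpace ℝ (Fin (n + 1)) → ℝ≥0∞} (hρ : Measurable ρ) (hρ1 : ∫⁻ u, ρ u ≠ ⊤) :
    ∀ᵐ a, pushDensity ρ f a ≠ ⊤ := by
  obtain ⟨h1, h2⟩ := coarea_weight hf hgrad hρ (Z := 1) measurable_one
  simp only [Pi.one_apply, one_mul] at h1 h2
  filter_upwards [ae_lt_top h1 (by rwa [h2])] with a ha
  exact ha.ne

theorem lintegral_near_zero_le (hf : Differentiable ℝ f)
    (hgrad : volume {u | gradient f u = 0} = 0)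
    {ρ Z : EuclideanSpace ℝ (Fin (n + 1)) → ℝ≥0∞} (hρ : Measurable ρ) (hρ1 : ∫⁻ u, ρ u ≠ ⊤)
    (hZ : Measurable Z) {c : ℝ≥0∞} {ε δ : ℝ} (hδε : δ ≤ ε)
    (hb : ∀ᵐ a : ℝ, a ∈ Ioo (-ε) ε → condExpect ρ f Z a * pushDensity ρ f a ≤ c) :
    ∫⁻ u in f ⁻¹' Ioo (-δ) δ, Z u ∂volume.withDensity ρ ≤ ENNReal.ofReal (2 * δ) * c := by
  have hfm : Measurable f := hf.continuous.measurable
  have hm : MeasurableSet (f ⁻¹' Ioo (-δ) δ) := hfm measurableSet_Ioo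
  rw [← lintegral_indicator hm, lintegral_withDensity_eq_lintegral_mul _ hρ (hZ.indicator hm)]
  have h := (coarea_weight hf hgrad hρ (hZ.indicator hm)).2
  simp only [Pi.mul_apply]
  simp_rw [mul_comm (ρ _)]
  rw [← h]
  have hvol : ∫⁻ a, (Ioo (-δ) δ).indicator (fun _ => c) a = ENNReal.ofReal (2 * δ) * c := by
    rw [lintegral_indicator measurableSet_Ioo, setLIntegral_const, Real.volume_Ioo, mul_comm]
    congr 2
    ring
  rw [← hvol]
  refine lintegral_mono_ae ?_
  filter_upwards [hb, ae_pushDensity_ne_top hf hgrad hρ hρ1] with a ha hfin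
  by_cases hmem : a ∈ Ioo (-δ) δ
  · rw [indicator_of_mem hmem]
    have hmem' : a ∈ Ioo (-ε) ε := ⟨by linarith [hmem.1], by linarith [hmem.2]⟩
    refine le_trans ?_ (ha hmem')
    rw [condExpect_mul_pushDensity hρ hfin]
    refine lintegral_mono fun u => ?_
    gcongr
    exact indicator_le_self _ _ u
  · rw [indicator_of_notMem hmem]
    refine le_of_eq ?_
    rw [← lintegral_zero (μ := fiberVolume f a)]
    refine setLIntegral_congr_fun (hfm (measurableSet_singleton a)) fun u hu => ?_
    have hu' : f u = a := hu
    rw [indicator_of_notMem (by simpa [hu'] using hmem), zero_mul]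

end density

/-! ### Regularity of the slices of `F` -/

section field

variable {V : Type*} [NormedAddCommGroup V] [NormedSpace ℝ V] {F : V → ℝ → ℝ} {x₀ x₁ : ℝ}

theorem contDiff_slice (hF : ContDiffOn ℝ ∞ (fun p : V × ℝ => F p.1 p.2) (univ ×ˢ Icc x₀ x₁))
    {x : ℝ} (hx : x ∈ Icc x₀ x₁) : ContDiff ℝ ∞ fun u => F u x := by
  have : ContDiff ℝ ∞ fun u : V => (u, x) := by fun_prop
  exact hF.comp_contDiff this fun u => ⟨mem_univ _, hx⟩

theorem hasDerivWithinAt_slice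
    (hF : ContDiffOn ℝ ∞ (fun p : V × ℝ => F p.1 p.2) (univ ×ˢ Icc x₀ x₁))
    (u : V) {x : ℝ} (hx : x ∈ Icc x₀ x₁) :
    HasDerivWithinAt (F u) (fderivWithin ℝ (fun p : V × ℝ => F p.1 p.2) (univ ×ˢ Icc x₀ x₁)
      (u, x) (0, 1)) (Icc x₀ x₁) x := by
  have h1 := ((hF.differentiableOn (by simp)) (u, x) ⟨mem_univ _, hx⟩).hasFDerivWithinAt
  have h2 : HasDerivWithinAt (fun y : ℝ => (u, y)) ((0 : V), (1 : ℝ)) (Icc x₀ x₁) x :=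
    (hasDerivWithinAt_const x _ u).prodMk (hasDerivWithinAt_id x _)
  exact h1.comp_hasDerivWithinAt x h2 fun y hy => ⟨mem_univ _, hy⟩

/-- The strict inequality `x₀ < x₁` gives unique differentiability of the slab, so one-sided
derivatives are values of the jointly continuous `fderivWithin`. -/
theorem continuousOn_derivWithin_slice (hx : x₀ < x₁)
    (hF : ContDiffOn ℝ ∞ (fun p : V × ℝ => F p.1 p.2) (univ ×ˢ Icc x₀ x₁)) :
    ContinuousOn (fun p : V × ℝ => derivWithin (F p.1) (Icc x₀ x₁) p.2)
      (univ ×ˢ Icc x₀ x₁) := by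
  have h1 := hF.continuousOn_fderivWithin
    (uniqueDiffOn_univ.prod (uniqueDiffOn_Icc hx)) (by simp)
  refine (h1.clm_apply (continuousOn_const (c := ((0 : V), (1 : ℝ))))).congr fun p hp => ?_
  exact (hasDerivWithinAt_slice hF p.1 hp.2).derivWithin (uniqueDiffOn_Icc hx p.2 hp.2)

end field

end Rice

end

/-! ### The bound on the expected number of zeros -/

theorem theorem3p2 (N : ℕ) (x₀ x₁ : ℝ) (hx : x₀ ≤ x₁)
    (F : EuclideanSpace ℝ (Fin N) → ℝ → ℝ)
    (hF : ContDiffOn ℝ ∞ (fun p : EuclideanSpace ℝ (Fin N) × ℝ => F p.1 p.2)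
      (univ ×ˢ Icc x₀ x₁))
    (hgrad : ∀ x ∈ Icc x₀ x₁, volume {u | gradient (fun v => F v x) u = 0} = 0)
    (hfin : ∀ᵐ u, (Rice.zerosOn (F u) x₀ x₁).Finite)
    (ρ : EuclideanSpace ℝ (Fin N) → ℝ≥0∞) (hρ : Measurable ρ) (hρ1 : ∫⁻ u, ρ u = 1)
    (g : ℝ → ℝ≥0∞) (hg : AEMeasurable g (volume.restrict (Icc x₀ x₁)))
    (hgint : ∫⁻ x in Icc x₀ x₁, g x < ⊤)
    (ε : ℝ) (hε : 0 < ε)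
    (hbound : ∀ x ∈ Icc x₀ x₁, ∀ᵐ a : ℝ, a ∈ Ioo (-ε) ε →
      Rice.condExpect ρ (fun u => F u x)
          (fun u => ENNReal.ofReal |derivWithin (F u) (Icc x₀ x₁) x|) a *
        Rice.pushDensity ρ (fun u => F u x) a ≤ g x) :
    AEMeasurable (fun u => Rice.zeroCount (F u) x₀ x₁) (volume.withDensity ρ) ∧
      ∫⁻ u, Rice.zeroCount (F u) x₀ x₁ ∂(volume.withDensity ρ) ≤ ∫⁻ x in Icc x₀ x₁, g x := by
  open Rice Filter Topology in
  refine ⟨(measurable_zeroCount hF.continuousOn).aemeasurable, ?_⟩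
  have hx₀ : x₀ ∈ Icc x₀ x₁ := left_mem_Icc.2 hx
  have hx₁ : x₁ ∈ Icc x₀ x₁ := right_mem_Icc.2 hx
  obtain _ | n := N
  -- For `N = 0` every gradient vanishes, so the critical set is the whole one-point space, which is
  -- not null.
  · have := hgrad x₀ hx₀
    rw [show {u | gradient (fun v => F v x₀) u = 0} = univ from
      eq_univ_of_forall fun u => Subsingleton.elim _ _] at this
    exact absurd this (NeZero.ne _)
  set μ : Measure (EuclideanSpace ℝ (Fin (n + 1))) := volume.withDensity ρ with hμ
  have hac : μ ≪ volume := withDensity_absolutelyContinuous _ _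
  have : IsFiniteMeasure μ := isFiniteMeasure_withDensity (by simp [hρ1])
  have hdiff : ∀ x ∈ Icc x₀ x₁, Differentiable ℝ fun u => F u x := fun x hx =>
    (contDiff_slice hF hx).differentiable (by simp)
  have hend : ∀ x ∈ Icc x₀ x₁, ∀ᵐ u ∂μ, F u x ≠ 0 := fun x hx =>
    hac.ae_le (ae_ne_of_volume_gradient_eq_zero (hdiff x hx) (hgrad x hx) 0)
  obtain rfl | hlt := hx.eq_or_lt
  -- For a one-point interval there is almost surely no zero, and derivatives within it carry no
  -- information.
  · refine le_of_eq_of_le ?_ zero_le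
    rw [← lintegral_zero (μ := μ)]
    refine lintegral_congr_ae ?_
    filter_upwards [hend x₀ hx₀] with u hu
    have : zerosOn (F u) x₀ x₀ = ∅ := by
      refine eq_empty_of_forall_notMem fun x hx => hu ?_
      rw [← hx.2, le_antisymm hx.1.1 hx.1.2]
    simp [zeroCount, this]
  -- the integrand of the approximate zero count, and its measurability
  let S : Set (EuclideanSpace ℝ (Fin (n + 1)) × ℝ) := univ ×ˢ Icc x₀ x₁
  have hS : MeasurableSet S := MeasurableSet.univ.prod measurableSet_Icc
  let φ : EuclideanSpace ℝ (Fin (n + 1)) → ℝ → ℝ := fun u x => derivWithin (F u) (Icc x₀ x₁) x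
  have hφ : ContinuousOn (fun p : EuclideanSpace ℝ (Fin (n + 1)) × ℝ => φ p.1 p.2) S :=
    continuousOn_derivWithin_slice hlt hF
  have hder : ∀ u, ∀ x ∈ Icc x₀ x₁, HasDerivWithinAt (F u) (φ u x) (Icc x₀ x₁) x :=
    fun u x hx => (hasDerivWithinAt_slice hF u hx).differentiableWithinAt.hasDerivWithinAt
  let A : ℝ → Set (EuclideanSpace ℝ (Fin (n + 1)) × ℝ) := fun δ =>
    S ∩ (fun p : EuclideanSpace ℝ (Fin (n + 1)) × ℝ => F p.1 p.2) ⁻¹' Ioo (-δ) δ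
  have hA : ∀ δ, MeasurableSet (A δ) := fun δ =>
    measurableSet_inter_preimage_of_continuousOn hF.continuousOn hS isOpen_Ioo
  let q : ℝ → EuclideanSpace ℝ (Fin (n + 1)) × ℝ → ℝ≥0∞ := fun δ =>
    (A δ).indicator fun p => ENNReal.ofReal |φ p.1 p.2|
  have hq : ∀ δ, Measurable (q δ) := fun δ => by
    have h1 : Measurable (S.indicator fun p : EuclideanSpace ℝ (Fin (n + 1)) × ℝ =>
        ENNReal.ofReal |φ p.1 p.2|) := by
      have hc : ContinuousOn (fun p : EuclideanSpace ℝ (Fin (n + 1)) × ℝ =>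
          ENNReal.ofReal |φ p.1 p.2|) S :=
        ENNReal.continuous_ofReal.comp_continuousOn hφ.abs
      classical
      rw [← piecewise_eq_indicator]
      exact hc.measurable_piecewise continuousOn_const hS
    -- The derivative is only known to be continuous on `S`; cutting it off outside `S` first gives
    -- a globally measurable function, as Tonelli requires.
    have h2 : q δ = (A δ).indicator (S.indicator fun p => ENNReal.ofReal |φ p.1 p.2|) := by
      rw [indicator_indicator, inter_eq_left.2 inter_subset_left]
    rw [h2]
    exact h1.indicator (hA δ)
  have hqx : ∀ δ u, ∫⁻ x in Icc x₀ x₁, q δ (u, x) =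
      ∫⁻ x in Icc x₀ x₁ ∩ F u ⁻¹' Ioo (-δ) δ, ENNReal.ofReal |φ u x| := fun δ u => by
    have hm : MeasurableSet (Icc x₀ x₁ ∩ F u ⁻¹' Ioo (-δ) δ) :=
      measurableSet_inter_preimage_of_continuousOn
        (fun x hx => (hder u x hx).continuousWithinAt) measurableSet_Icc isOpen_Ioo
    rw [← lintegral_indicator measurableSet_Icc, ← lintegral_indicator hm]
    refine lintegral_congr fun x => ?_
    by_cases h1 : x ∈ Icc x₀ x₁ <;> by_cases h2 : F u x ∈ Ioo (-δ) δ <;>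
      simp only [q, A, S, indicator, mem_inter_iff, mem_prod, mem_univ, mem_preimage, h1, h2,
        and_true, and_false, if_true, if_false]
  have hqu : ∀ x ∈ Icc x₀ x₁, ∀ δ ≤ ε, ∫⁻ u, q δ (u, x) ∂μ ≤ ENNReal.ofReal (2 * δ) * g x := by
    intro x hx δ hδ
    have hZ : Measurable fun u => ENNReal.ofReal |φ u x| := by
      have : Continuous fun u => φ u x :=
        hφ.comp_continuous (f := fun u => (u, x)) (by fun_prop) fun u => ⟨mem_univ _, hx⟩
      fun_prop
    refine le_of_eq_of_le ?_ (lintegral_near_zero_le (hdiff x hx) (hgrad x hx) hρ (by simp [hρ1])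
      hZ hδ (hbound x hx))
    rw [← lintegral_indicator ((hdiff x hx).continuous.measurable measurableSet_Ioo)]
    refine lintegral_congr fun u => ?_
    by_cases h2 : F u x ∈ Ioo (-δ) δ <;>
      simp only [q, A, S, indicator, mem_inter_iff, mem_prod, mem_univ, mem_preimage, hx, h2,
        and_true, and_false, if_true, if_false]
  -- Fatou's lemma along a sequence of shrinking neighborhoods of `0`
  obtain ⟨δ, -, hδ0, hδ⟩ := exists_seq_strictAnti_tendsto' hε
  have hδpos : ∀ m, 0 < ENNReal.ofReal (2 * δ m) := fun m =>
    ENNReal.ofReal_pos.2 (by linarith [(hδ0 m).1])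
  have hδlim : Tendsto δ atTop (𝓝[>] 0) :=
    tendsto_nhdsWithin_iff.2 ⟨hδ, Eventually.of_forall fun m => (hδ0 m).1⟩
  let G : ℕ → EuclideanSpace ℝ (Fin (n + 1)) → ℝ≥0∞ := fun m u =>
    (ENNReal.ofReal (2 * δ m))⁻¹ * ∫⁻ x in Icc x₀ x₁, q (δ m) (u, x)
  have hGm : ∀ m, Measurable (G m) := fun m => ((hq (δ m)).lintegral_prod_right').const_mul _
  have hGle : ∀ m, ∫⁻ u, G m u ∂μ ≤ ∫⁻ x in Icc x₀ x₁, g x := fun m => by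
    -- After the swap, the bound for each fixed `x` carries a factor `2 * δ m`, which cancels the
    -- normalization of `G m`.
    rw [lintegral_const_mul _ (hq (δ m)).lintegral_prod_right',
      lintegral_lintegral_swap (f := fun u x => q (δ m) (u, x)) (hq (δ m)).aemeasurable,
      ENNReal.inv_mul_le_iff (hδpos m).ne' ENNReal.ofReal_ne_top,
      ← lintegral_const_mul' _ _ ENNReal.ofReal_ne_top]
    refine setLIntegral_mono' measurableSet_Icc fun x hx => hqu x hx _ (hδ0 m).2.le
  calc ∫⁻ u, zeroCount (F u) x₀ x₁ ∂μ ≤ ∫⁻ u, liminf (fun m => G m u) atTop ∂μ := by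
        refine lintegral_mono_ae ?_
        filter_upwards [hac.ae_le hfin, hend x₀ hx₀, hend x₁ hx₁] with u hu h0 h1
        refine le_liminf_of_le (by isBoundedDefault) ?_
        filter_upwards [hδlim.eventually
          (eventually_zeroCount_le_lintegral (hder u) hu h0 h1)] with m hm
        rw [← hqx] at hm
        rw [← ENNReal.mul_le_iff_le_inv (hδpos m).ne' ENNReal.ofReal_ne_top]
        exact hm
    _ ≤ liminf (fun m => ∫⁻ u, G m u ∂μ) atTop := lintegral_liminf_le hGm
    _ ≤ ∫⁻ x in Icc x₀ x₁, g x :=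
        liminf_le_of_le (by isBoundedDefault) fun b hb => by
          obtain ⟨m, hm⟩ := hb.exists
          exact hm.trans (hGle m)
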